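/- Consider a base station with a uniform planar array and a single-antenna user, connected by $M$ paths. For $N_f$ subcarriers with frequencies $f_k=f_1+(k-1)\Delta f$, $\Delta f>0$, the wideband channel at time $t$ is the random matrix $\mathbf H(t)=\mathbf G(t)\mathbf B$. Row $m$ of $\mathbf B$ is the delay response $(e^{-j2\pi f_1\tau_m},\dots,e^{-j2\pi f_{N_f}\tau_m})$ of path $m$. Column $m$ of $\mathbf G(t)$ holds the gains of path $m$ at the antennas: for each polarization $i$ it is the steering vector at the departure angles of the path, times $$c_{i,m}(t)=\mathbf F_{\rm rx}^T\begin{bmatrix}e^{j\Phi_m^{\theta\theta}}&\sqrt{\kappa_m^{-1}}e^{j\Phi_m^{\theta\varphi}}\\ \sqrt{\kappa_m^{-1}}e^{j\Phi_m^{\varphi\theta}}&e^{j\Phi_m^{\varphi\varphi}}\end{bmatrix}\mathbf F_{{\rm tx},i}\;e^{j2\pi \hat{\mathbf r}_{{\rm rx},m}^T\bar{\mathbf v}t/\lambda_0},$$ where $\mathbf F_{\rm rx}$ and $\mathbf F_{{\rm tx},i}$ are the field patterns at the angles of arrival and of departure, $\hat{\mathbf r}_{{\rm rx},m}$ is the unit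 vector of arrival, $\bar{\mathbf v}$ the velocity of the user and $\lambda_0$ the wavelength. The angles, the cross polarization ratios $\kappa_m>0$ and the delays $\tau_m$ are random with an arbitrary joint law; the initial phases $\Phi$ are independent, uniform on $(-\pi,\pi)$, and independent of these. The frequency covariance is the $N_f\times N_f$ matrix $\mathbf R^{(\mathrm F)}=\mathbb E\{\mathbf H(t)^T\mathbf H(t)^*\}$. Suppose that the power delay profile, i.e. the measure $B\mapsto\sum_m\mathbb E\{\|\mathbf G(t)_{\cdot,m}\|_2^2\,\mathbf 1[\tau_m\in B]\}$, has an integrable density that is positive inside $Q$ delay intervals $[\tau_q^{\min},\tau_q^{\max}]$, $q=1,\dots,Q$, and zero outside their union. Suppose that the interiors of the intervals are pairwise disjoint modulo $1/\Delta f$ (as they are when they are pairwise disjoint and all delays lie in $[0,1/\Delta f]$). Then the rank of $\mathbf R^{(\mathrm F)}$, in the asymptotic sense of the number of its non-negligible eigenvalues, satisfies $\mathrm{rank}\{\mathbf R^{(\mathrm F)}\}/N_f\to\rho^{(\mathrm F)}$ as $N_f\to\infty$, with $$\rho^{(\mathrm F)}=\min\Big\{\sum_{q=1}^Q\Delta f\,(\tau_q^{\max}-\tau_q^{\min}),\,1\Big\}.$$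 Precisely: let $r_\varepsilon(N_f)$ be the number of eigenvalues of $\mathbf R^{(\mathrm F)}$, with multiplicity, that exceed $\varepsilon$. Then for every $\delta>0$ there is $\varepsilon_0>0$ such that for every $\varepsilon\in(0,\varepsilon_0)$, for all sufficiently large $N_f$, $\big|r_\varepsilon(N_f)/N_f-\rho^{(\mathrm F)}\big|<\delta$; that is, $\lim_{\varepsilon\downarrow0}\liminf_{N_f\to\infty} r_\varepsilon(N_f)/N_f=\lim_{\varepsilon\downarrow0}\limsup_{N_f\to\infty} r_\varepsilon(N_f)/N_f=\rho^{(\mathrm F)}$. -/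

import Mathlib

open MeasureTheory ProbabilityTheory Filter Topology

noncomputable section

namespace Wideband

/-- The matrix of random initial phases of one path with cross polarization ratio `κ`: unit diagonal
amplitudes, off-diagonal amplitudes `√(κ⁻¹)`, and the phase `Φ i j` in entry `(i, j)`. -/
def polarizationMatrix (κ : ℝ) (Φ : Fin 2 → Fin 2 → ℝ) : Matrix (Fin 2) (Fin 2) ℂ :=
  Matrix.of fun i j =>
    (if i = j then 1 else (Real.sqrt κ⁻¹ : ℂ)) * Complex.exp (Complex.I * (Φ i j : ℂ))

/-- The unit vector with zenith angle `θ` and azimuth angle `φ`. -/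
def sphericalUnit (θ φ : ℝ) : Fin 3 → ℝ :=
  ![Real.sin θ * Real.cos φ, Real.sin θ * Real.sin φ, Real.cos θ]

/-- Horizontal steering vector, for antenna spacing `D` and wavelength `lam`. -/
def steeringH (D lam : ℝ) (n : ℕ) (θ φ : ℝ) : Fin n → ℂ := fun h =>
  Complex.exp (Complex.I * ((2 * Real.pi * (h : ℝ) * D * Real.sin θ * Real.sin φ / lam : ℝ) : ℂ))

/-- Vertical steering vector, for antenna spacing `D` and wavelength `lam`. -/
def steeringV (D lam : ℝ) (n : ℕ) (θ : ℝ) : Fin n → ℂ := fun v =>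
  Complex.exp (Complex.I * ((2 * Real.pi * (v : ℝ) * D * Real.cos θ / lam : ℝ) : ℂ))

/-- Frequency of the `k`-th of equally spaced subcarriers, with first frequency `f₁` and spacing
`Δf` (`k` starts at `0`). -/
def subcarrier (f₁ Δf : ℝ) (k : ℕ) : ℝ := f₁ + k * Δf

/-- Delay response vector of a path with delay `τ`, over `N` subcarriers. -/
def delayResponse (f₁ Δf : ℝ) (N : ℕ) (τ : ℝ) : Fin N → ℂ := fun k =>
  Complex.exp (-(Complex.I * ((2 * Real.pi * subcarrier f₁ Δf k * τ : ℝ) : ℂ)))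

/-- The random geometry-based multipath channel between a base station with a uniform planar array
(`Nh` columns, `Nv` rows, `Np` polarizations) and a single-antenna user, with `M` paths.
The angles, the cross polarization ratios and the delays of the paths are random variables with an
arbitrary joint law. The initial phases are independent, uniform, and independent of them. -/
structure Channel (Ω : Type*) [MeasurableSpace Ω] (μ : Measure Ω) (M Nh Nv Np : ℕ) where
  /-- wavelength of the center frequency -/
  wavelength : ℝ
  wavelength_pos : 0 < wavelength
  /-- horizontal antenna spacing -/
  Dh : ℝ
  /-- vertical antenna spacing -/
  Dv : ℝ
  /-- velocity vector of the user -/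
  velocity : Fin 3 → ℝ
  /-- field pattern of the user antenna (zenith and azimuth component), a function of the angles -/
  Frx : Fin 2 → ℝ → ℝ → ℝ
  /-- field pattern of the base station antennas of each polarization -/
  Ftx : Fin Np → Fin 2 → ℝ → ℝ → ℝ
  measurable_Frx : ∀ i, Measurable fun x : ℝ × ℝ => Frx i x.1 x.2
  measurable_Ftx : ∀ p i, Measurable fun x : ℝ × ℝ => Ftx p i x.1 x.2
  /-- zenith angle of arrival -/
  zoa : Fin M → Ω → ℝ
  /-- azimuth angle of arrival -/
  aoa : Fin M → Ω → ℝ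
  /-- zenith angle of departure -/
  zod : Fin M → Ω → ℝ
  /-- azimuth angle of departure -/
  aod : Fin M → Ω → ℝ
  /-- cross polarization ratio -/
  xpr : Fin M → Ω → ℝ
  /-- delay -/
  delay : Fin M → Ω → ℝ
  /-- initial phases of the four polarization combinations -/
  phase : Fin M → Fin 2 → Fin 2 → Ω → ℝ
  measurable_zoa : ∀ m, Measurable (zoa m)
  measurable_aoa : ∀ m, Measurable (aoa m)
  measurable_zod : ∀ m, Measurable (zod m)
  measurable_aod : ∀ m, Measurable (aod m)
  measurable_xpr : ∀ m, Measurable (xpr m)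
  measurable_delay : ∀ m, Measurable (delay m)
  measurable_phase : ∀ m i j, Measurable (phase m i j)
  xpr_pos : ∀ m, ∀ᵐ ω ∂μ, 0 < xpr m ω
  phase_uniform : ∀ m i j,
    pdf.IsUniform (phase m i j) (Set.Ioo (-Real.pi) Real.pi) μ volume
  phase_indep : iIndepFun (fun (x : Fin M × Fin 2 × Fin 2) => phase x.1 x.2.1 x.2.2) μ
  phase_indep_rest : IndepFun
    (fun ω (x : Fin M × Fin 2 × Fin 2) => phase x.1 x.2.1 x.2.2 ω)
    (fun ω (m : Fin M) => (zoa m ω, aoa m ω, zod m ω, aod m ω, xpr m ω, delay m ω)) μ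

namespace Channel

variable {Ω : Type*} [MeasurableSpace Ω] {μ : Measure Ω} {M Nh Nv Np : ℕ}

/-- Coefficient of path `m` for polarization `p` at time `t`: receive pattern, polarization matrix,
transmit pattern, and Doppler factor. -/
def pathCoeff (H : Channel Ω μ M Nh Nv Np) (t : ℝ) (ω : Ω) (p : Fin Np) (m : Fin M) : ℂ :=
  ((fun i => (H.Frx i (H.zoa m ω) (H.aoa m ω) : ℂ)) ⬝ᵥ
      (polarizationMatrix (H.xpr m ω) (fun i j => H.phase m i j ω)).mulVec
        (fun j => (H.Ftx p j (H.zod m ω) (H.aod m ω) : ℂ))) *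
    Complex.exp (Complex.I *
      ((2 * Real.pi * (sphericalUnit (H.zoa m ω) (H.aoa m ω) ⬝ᵥ H.velocity) / H.wavelength * t
        : ℝ) : ℂ))

/-- The matrix whose columns are the steering vectors of the paths (the Kronecker product of the
horizontal and the vertical steering vector). -/
def steeringMatrix (H : Channel Ω μ M Nh Nv Np) (ω : Ω) :
    Matrix (Fin Nh × Fin Nv) (Fin M) ℂ :=
  Matrix.of fun s m =>
    steeringH H.Dh H.wavelength Nh (H.zod m ω) (H.aod m ω) s.1 *
      steeringV H.Dv H.wavelength Nv (H.zod m ω) s.2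

/-- The stacked diagonal matrices of path coefficients, one for each polarization. -/
def coeffMatrix (H : Channel Ω μ M Nh Nv Np) (t : ℝ) (ω : Ω) :
    Matrix (Fin M × Fin Np) (Fin M) ℂ :=
  Matrix.of fun x m => if x.1 = m then H.pathCoeff t ω x.2 m else 0

/-- Column `m` holds the complex gains of path `m` at all base station antennas. -/
def gainMatrix (H : Channel Ω μ M Nh Nv Np) (t : ℝ) (ω : Ω) :
    Matrix ((Fin Nh × Fin Nv) × Fin Np) (Fin M) ℂ :=
  Matrix.blockDiagonal (fun _ : Fin Np => H.steeringMatrix ω) * H.coeffMatrix t ω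

/-- The matrix whose rows are the delay response vectors of the paths. -/
def delayMatrix (H : Channel Ω μ M Nh Nv Np) (f₁ Δf : ℝ) (N : ℕ) (ω : Ω) :
    Matrix (Fin M) (Fin N) ℂ :=
  Matrix.of fun m => delayResponse f₁ Δf N (H.delay m ω)

/-- The wideband channel matrix (antennas by subcarriers) at time `t`. -/
def channelMatrix (H : Channel Ω μ M Nh Nv Np) (f₁ Δf : ℝ) (N : ℕ) (t : ℝ) (ω : Ω) :
    Matrix ((Fin Nh × Fin Nv) × Fin Np) (Fin N) ℂ :=
  H.gainMatrix t ω * H.delayMatrix f₁ Δf N ω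

/-- The frequency covariance matrix `𝔼 {Hᵀ H^*}`, where `H^*` is the entrywise conjugate. -/
def freqCov (H : Channel Ω μ M Nh Nv Np) (f₁ Δf : ℝ) (N : ℕ) (t : ℝ) :
    Matrix (Fin N) (Fin N) ℂ :=
  Matrix.of fun k l => ∫ ω,
    ((H.channelMatrix f₁ Δf N t ω).transpose *
      (H.channelMatrix f₁ Δf N t ω).map (starRingEnd ℂ)) k l ∂μ

/-- The power delay profile as a measure on the delay axis: the mass of `B` is the mean
power, summed over the antennas, of the paths whose delay lies in `B`. -/
def powerDelayProfile (H : Channel Ω μ M Nh Nv Np) (t : ℝ) : Measure ℝ :=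
  ∑ m, (μ.withDensity fun ω => ∑ s, ‖H.gainMatrix t ω s m‖ₑ ^ 2).map (H.delay m)

theorem freqCov_isHermitian (H : Channel Ω μ M Nh Nv Np) (f₁ Δf : ℝ) (N : ℕ) (t : ℝ) :
    (H.freqCov f₁ Δf N t).IsHermitian := by
  ext k l
  simp only [freqCov, Matrix.conjTranspose_apply, Matrix.of_apply]
  change (starRingEnd ℂ) _ = _
  rw [← integral_conj]
  congr 1
  ext ω
  simp only [Matrix.mul_apply, Matrix.transpose_apply, Matrix.map_apply, map_sum, map_mul,
    Complex.conj_conj]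
  exact Finset.sum_congr rfl fun s _ => mul_comm _ _

end Channel

/-- The number of eigenvalues, with multiplicity, of a Hermitian matrix that exceed `ε`. -/
def effectiveRank {n : Type*} [Fintype n] [DecidableEq n] {A : Matrix n n ℂ}
    (hA : A.IsHermitian) (ε : ℝ) : ℕ :=
  Fintype.card {i : n // ε < hA.eigenvalues i}

end Wideband

end

/-! Rotating all four initial phases of one path by half a turn preserves the joint law, since the
phases are uniform, independent, and independent of the other parameters, and it changes the sign of
that path's gain only. Cross terms between different paths therefore average to zero. In the
remaining terms the first frequency cancels, and the covariance is the Toeplitz matrix of Fourier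
coefficients of the power delay profile wrapped around the circle of length `1 / Δf`
(`freqCov_eq_toeplitz`).

What remains is a weak form of Szegő's theorem: the fraction of non-negligible eigenvalues tends to
the normalized Haar measure of the set where the wrapped density `f` is non-zero. For an indicator
symbol the Toeplitz matrix lies between 0 and 1, and by Parseval its trace and squared Frobenius
norm agree up to `o(N)`; so all but `o(N)` eigenvalues lie close to 0 or 1, and the trace counts
those near 1. A general `f` is compared with indicators: from below through a superlevel set `{c ≤
f}`, from above through `f ≤ K · 1_{f ≠ 0} + (f - K)⁺`, where the last term has small trace. Weyl's
inequality (`effectiveRank_le_add`) turns these bounds into eigenvalue counts.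

Finally `{f ≠ 0}` is, up to null sets, the wrapped union of the intervals
(`exists_density_map_coe`), whose measure is `ρ` by disjointness (`haarAddCircle_iUnion_image_Ioo`).
-/

noncomputable section

namespace Wideband

/-! ### Eigenvalue counting through quadratic forms, trace and Frobenius norm. -/

section QuadraticForm

variable {n : Type*} [Fintype n] [DecidableEq n]

theorem sum_norm_sq_unitary_mulVec {U : Matrix n n ℂ} (hU : star U * U = 1) (c : n → ℂ) :
    ∑ i, ‖U.mulVec c i‖ ^ 2 = ∑ i, ‖c i‖ ^ 2 := by
  have key : ∀ v : n → ℂ, ((∑ i, ‖v i‖ ^ 2 : ℝ) : ℂ) = star v ⬝ᵥ v := by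
    intro v
    simp only [dotProduct, Pi.star_apply, RCLike.star_def, Complex.conj_mul']
    push_cast
    rfl
  have : ((∑ i, ‖U.mulVec c i‖ ^ 2 : ℝ) : ℂ) = ((∑ i, ‖c i‖ ^ 2 : ℝ) : ℂ) := by
    rw [key, key, Matrix.star_mulVec, ← Matrix.dotProduct_mulVec, Matrix.mulVec_mulVec,
      ← Matrix.star_eq_conjTranspose, hU, Matrix.one_mulVec]
  exact_mod_cast this

/-- Coordinates of a vector in the eigenvector basis of a Hermitian matrix. -/
def eigenCoord {A : Matrix n n ℂ} (hA : A.IsHermitian) (v : n → ℂ) : n → ℂ :=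
  (star (hA.eigenvectorUnitary : Matrix n n ℂ)).mulVec v

theorem sum_norm_sq_eigenCoord {A : Matrix n n ℂ} (hA : A.IsHermitian) (v : n → ℂ) :
    ∑ i, ‖eigenCoord hA v i‖ ^ 2 = ∑ i, ‖v i‖ ^ 2 := by
  apply sum_norm_sq_unitary_mulVec
  rw [star_star]
  exact Unitary.coe_mul_star_self _

theorem quadForm_eq_sum_eigenvalues {A : Matrix n n ℂ} (hA : A.IsHermitian) (v : n → ℂ) :
    (star v ⬝ᵥ A.mulVec v).re = ∑ i, hA.eigenvalues i * ‖eigenCoord hA v i‖ ^ 2 := by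
  have h := hA.spectral_theorem
  rw [Unitary.conjStarAlgAut_apply] at h
  have : star v ⬝ᵥ A.mulVec v =
      star (eigenCoord hA v) ⬝ᵥ
        (Matrix.diagonal (RCLike.ofReal ∘ hA.eigenvalues : n → ℂ)).mulVec (eigenCoord hA v) := by
    conv_lhs => rw [h]
    rw [← Matrix.mulVec_mulVec, ← Matrix.mulVec_mulVec, Matrix.dotProduct_mulVec]
    congr 1
    rw [eigenCoord, Matrix.star_mulVec, ← Matrix.star_eq_conjTranspose, star_star]
  rw [this]
  simp only [dotProduct, Matrix.mulVec_diagonal, Pi.star_apply, Function.comp_apply,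
    RCLike.star_def, Complex.re_sum]
  refine Finset.sum_congr rfl fun i _ => ?_
  rw [mul_left_comm, Complex.conj_mul']
  simp [← Complex.ofReal_pow]

theorem eigenCoord_eigenvector_combination {A : Matrix n n ℂ} (hA : A.IsHermitian) (c : n → ℂ) :
    eigenCoord hA ((hA.eigenvectorUnitary : Matrix n n ℂ).mulVec c) = c := by
  rw [eigenCoord, Matrix.mulVec_mulVec, Unitary.coe_star_mul_self, Matrix.one_mulVec]

/-- Weyl's inequality for eigenvalue counting functions, in a form with a quadratic form bound. -/
theorem effectiveRank_le_add {A B C : Matrix n n ℂ} (hA : A.IsHermitian) (hB : B.IsHermitian)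
    (hC : C.IsHermitian) {K a β γ : ℝ} (hK : 0 ≤ K) (ha : K * β + γ ≤ a)
    (h : ∀ v : n → ℂ, (star v ⬝ᵥ A.mulVec v).re ≤
      K * (star v ⬝ᵥ B.mulVec v).re + (star v ⬝ᵥ C.mulVec v).re) :
    effectiveRank hA a ≤ effectiveRank hB β + effectiveRank hC γ := by
  classical
  -- Dimension count: if the inequality failed, the span of the eigenvectors of `A` above `a` would
  -- contain a non-zero `v` with no component along the eigenvectors of `B` above `β` or of `C`
  -- above `γ`. Then `a‖v‖² < ⟨v, A v⟩ ≤ (K β + γ)‖v‖²`, contrary to `ha`.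
  by_contra! hlt
  let ext : ({i // a < hA.eigenvalues i} → ℂ) →ₗ[ℂ] (n → ℂ) :=
    Function.ExtendByZero.linearMap ℂ Subtype.val
  let V : ({i // a < hA.eigenvalues i} → ℂ) →ₗ[ℂ] (n → ℂ) :=
    (Matrix.mulVecLin (hA.eigenvectorUnitary : Matrix n n ℂ)) ∘ₗ ext
  let FB : (n → ℂ) →ₗ[ℂ] ({i // β < hB.eigenvalues i} → ℂ) :=
    LinearMap.funLeft ℂ ℂ Subtype.val ∘ₗ
      Matrix.mulVecLin (star (hB.eigenvectorUnitary : Matrix n n ℂ))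
  let FC : (n → ℂ) →ₗ[ℂ] ({i // γ < hC.eigenvalues i} → ℂ) :=
    LinearMap.funLeft ℂ ℂ Subtype.val ∘ₗ
      Matrix.mulVecLin (star (hC.eigenvectorUnitary : Matrix n n ℂ))
  have hker : LinearMap.ker ((FB.prod FC) ∘ₗ V) ≠ ⊥ := by
    apply LinearMap.ker_ne_bot_of_finrank_lt
    rw [Module.finrank_prod, Module.finrank_pi, Module.finrank_pi, Module.finrank_pi]
    exact hlt
  obtain ⟨c, hc, hc0⟩ := Submodule.exists_mem_ne_zero_of_ne_bot hker
  set v := V c with hv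
  have hcB : ∀ i, β < hB.eigenvalues i → eigenCoord hB v i = 0 := fun i hi =>
    congrFun (congrArg Prod.fst hc) ⟨i, hi⟩
  have hcC : ∀ i, γ < hC.eigenvalues i → eigenCoord hC v i = 0 := fun i hi =>
    congrFun (congrArg Prod.snd hc) ⟨i, hi⟩
  have hcA : eigenCoord hA v = ext c := eigenCoord_eigenvector_combination hA _
  have hext : ∀ i : {i // a < hA.eigenvalues i}, ext c i = c i := fun i =>
    Subtype.val_injective.extend_apply _ _ _
  have hext' : ∀ i, ¬ a < hA.eigenvalues i → ext c i = 0 := fun i hi =>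
    Function.extend_apply' _ _ _ (by rintro ⟨j, rfl⟩; exact hi j.2)
  have hqB : (star v ⬝ᵥ B.mulVec v).re ≤ β * ∑ i, ‖v i‖ ^ 2 := by
    rw [quadForm_eq_sum_eigenvalues hB, ← sum_norm_sq_eigenCoord hB, Finset.mul_sum]
    refine Finset.sum_le_sum fun i _ => ?_
    rcases lt_or_ge β (hB.eigenvalues i) with hi | hi
    · simp [hcB i hi]
    · gcongr
  have hqC : (star v ⬝ᵥ C.mulVec v).re ≤ γ * ∑ i, ‖v i‖ ^ 2 := by
    rw [quadForm_eq_sum_eigenvalues hC, ← sum_norm_sq_eigenCoord hC, Finset.mul_sum]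
    refine Finset.sum_le_sum fun i _ => ?_
    rcases lt_or_ge γ (hC.eigenvalues i) with hi | hi
    · simp [hcC i hi]
    · gcongr
  have hqA : a * ∑ i, ‖v i‖ ^ 2 < (star v ⬝ᵥ A.mulVec v).re := by
    rw [quadForm_eq_sum_eigenvalues hA, ← sum_norm_sq_eigenCoord hA, Finset.mul_sum, hcA]
    obtain ⟨j, hj⟩ := Function.ne_iff.mp hc0
    refine Finset.sum_lt_sum (fun i _ => ?_) ⟨j, Finset.mem_univ _, ?_⟩
    · by_cases hi : a < hA.eigenvalues i
      · gcongr
      · simp [hext' i hi]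
    · have : 0 < ‖ext c j‖ := by rw [hext]; exact norm_pos_iff.mpr hj
      have := j.2
      gcongr
  have hnn : 0 ≤ ∑ i, ‖v i‖ ^ 2 := by positivity
  have h1 := h v
  have h2 := mul_le_mul_of_nonneg_left hqB hK
  have h3 := mul_le_mul_of_nonneg_right ha hnn
  nlinarith

theorem eigenvalue_eq_quadForm {A : Matrix n n ℂ} (hA : A.IsHermitian) (i : n) :
    ∃ v : n → ℂ, ∑ j, ‖v j‖ ^ 2 = 1 ∧ (star v ⬝ᵥ A.mulVec v).re = hA.eigenvalues i := by
  refine ⟨(hA.eigenvectorUnitary : Matrix n n ℂ).mulVec (Pi.single i 1), ?_, ?_⟩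
  · rw [sum_norm_sq_unitary_mulVec (Unitary.coe_star_mul_self _)]
    simp [Pi.single_apply, apply_ite norm, ite_pow]
  · rw [quadForm_eq_sum_eigenvalues hA, eigenCoord_eigenvector_combination]
    simp [Pi.single_apply, apply_ite norm, ite_pow]

theorem eigenvalues_nonneg_of_quadForm {A : Matrix n n ℂ} (hA : A.IsHermitian)
    (h : ∀ v : n → ℂ, 0 ≤ (star v ⬝ᵥ A.mulVec v).re) (i : n) : 0 ≤ hA.eigenvalues i := by
  obtain ⟨v, -, hv⟩ := eigenvalue_eq_quadForm hA i
  exact hv ▸ h v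

theorem eigenvalues_le_one_of_quadForm {A : Matrix n n ℂ} (hA : A.IsHermitian)
    (h : ∀ v : n → ℂ, (star v ⬝ᵥ A.mulVec v).re ≤ ∑ i, ‖v i‖ ^ 2) (i : n) :
    hA.eigenvalues i ≤ 1 := by
  obtain ⟨v, hv1, hv⟩ := eigenvalue_eq_quadForm hA i
  exact hv ▸ hv1 ▸ h v

theorem sum_eigenvalues_eq_trace {A : Matrix n n ℂ} (hA : A.IsHermitian) :
    ∑ i, hA.eigenvalues i = A.trace.re := by
  rw [hA.trace_eq_sum_eigenvalues]
  simp

/-- Both sides compute the trace of `A * A`. -/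
theorem sum_sq_eigenvalues {A : Matrix n n ℂ} (hA : A.IsHermitian) :
    ∑ i, hA.eigenvalues i ^ 2 = ∑ k, ∑ l, ‖A k l‖ ^ 2 := by
  have h := hA.spectral_theorem
  rw [Unitary.conjStarAlgAut_apply] at h
  have h1 : (A * A).trace = ((∑ k, ∑ l, ‖A k l‖ ^ 2 : ℝ) : ℂ) := by
    simp only [Matrix.trace, Matrix.diag_apply, Matrix.mul_apply]
    push_cast
    refine Finset.sum_congr rfl fun k _ => Finset.sum_congr rfl fun l _ => ?_
    rw [← hA.apply l k, RCLike.star_def, Complex.mul_conj']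
  have h2 : (A * A).trace = ((∑ i, hA.eigenvalues i ^ 2 : ℝ) : ℂ) := by
    conv_lhs => rw [h]
    set U := (hA.eigenvectorUnitary : Matrix n n ℂ)
    set D := Matrix.diagonal (RCLike.ofReal ∘ hA.eigenvalues : n → ℂ)
    have hU : star U * U = 1 := Unitary.coe_star_mul_self _
    have : U * D * star U * (U * D * star U) = U * (D * D) * star U := by
      calc _ = U * D * (star U * U) * D * star U := by simp only [mul_assoc]
        _ = _ := by rw [hU]; simp only [mul_assoc, one_mul]
    rw [this, Matrix.trace_mul_comm, ← mul_assoc, hU, one_mul, Matrix.diagonal_mul_diagonal,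
      Matrix.trace_diagonal]
    push_cast
    exact Finset.sum_congr rfl fun i _ => by simp [sq]
  exact_mod_cast h2.symm.trans h1

theorem effectiveRank_eq_sum {A : Matrix n n ℂ} (hA : A.IsHermitian) (ε : ℝ) :
    (effectiveRank hA ε : ℝ) = ∑ i, if ε < hA.eigenvalues i then 1 else 0 := by
  rw [effectiveRank, Fintype.card_subtype]
  simp

/-- Markov's inequality for the eigenvalues. -/
theorem effectiveRank_mul_le_trace {A : Matrix n n ℂ} (hA : A.IsHermitian)
    (h : ∀ v : n → ℂ, 0 ≤ (star v ⬝ᵥ A.mulVec v).re) (ε : ℝ) :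
    effectiveRank hA ε * ε ≤ A.trace.re := by
  rw [effectiveRank_eq_sum, ← sum_eigenvalues_eq_trace hA, Finset.sum_mul]
  refine Finset.sum_le_sum fun i _ => ?_
  have := eigenvalues_nonneg_of_quadForm hA h i
  split_ifs with hi <;> linarith

/-- Eigenvalue by eigenvalue: for `x ∈ [0, 1]` with `x > η`, `1 - x ≤ x (1 - x) / η`. The sum of `x
(1 - x)` is trace minus squared Frobenius norm, and measures the distance from a projection. -/
theorem effectiveRank_le_of_contraction {A : Matrix n n ℂ} (hA : A.IsHermitian)
    (h0 : ∀ v : n → ℂ, 0 ≤ (star v ⬝ᵥ A.mulVec v).re)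
    (h1 : ∀ v : n → ℂ, (star v ⬝ᵥ A.mulVec v).re ≤ ∑ i, ‖v i‖ ^ 2) {η : ℝ} (hη : 0 < η) :
    (effectiveRank hA η : ℝ) ≤
      A.trace.re + (A.trace.re - ∑ k, ∑ l, ‖A k l‖ ^ 2) / η := by
  rw [effectiveRank_eq_sum, ← sum_eigenvalues_eq_trace hA, ← sum_sq_eigenvalues hA,
    ← Finset.sum_sub_distrib, Finset.sum_div, ← Finset.sum_add_distrib]
  refine Finset.sum_le_sum fun i _ => ?_
  have a0 := eigenvalues_nonneg_of_quadForm hA h0 i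
  have a1 := eigenvalues_le_one_of_quadForm hA h1 i
  generalize hA.eigenvalues i = x at *
  rw [← sub_le_iff_le_add', le_div_iff₀ hη]
  split_ifs with hi <;> nlinarith

/-- The companion bound: if `0 ≤ x ≤ η` then `x ≤ x (1 - x) / (1 - η)`, so eigenvalues not counted
contribute at most zero on the left. -/
theorem le_effectiveRank_of_contraction {A : Matrix n n ℂ} (hA : A.IsHermitian)
    (h0 : ∀ v : n → ℂ, 0 ≤ (star v ⬝ᵥ A.mulVec v).re)
    (h1 : ∀ v : n → ℂ, (star v ⬝ᵥ A.mulVec v).re ≤ ∑ i, ‖v i‖ ^ 2) {η : ℝ} (hη : η < 1) :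
    A.trace.re - (A.trace.re - ∑ k, ∑ l, ‖A k l‖ ^ 2) / (1 - η) ≤ effectiveRank hA η := by
  rw [effectiveRank_eq_sum, ← sum_eigenvalues_eq_trace hA, ← sum_sq_eigenvalues hA,
    ← Finset.sum_sub_distrib, Finset.sum_div, ← Finset.sum_sub_distrib]
  refine Finset.sum_le_sum fun i _ => ?_
  have a0 := eigenvalues_nonneg_of_quadForm hA h0 i
  have a1 := eigenvalues_le_one_of_quadForm hA h1 i
  generalize hA.eigenvalues i = x at *
  rw [sub_le_comm, le_div_iff₀ (by linarith)]
  split_ifs with hi <;> nlinarith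

end QuadraticForm

/-! ### Toeplitz matrices of measures on the circle; indicator symbols. -/

section Toeplitz

variable {T : ℝ}

/-- The Toeplitz matrix of the Fourier coefficients of a measure on the circle. -/
def toeplitz (ν : Measure (AddCircle T)) (N : ℕ) : Matrix (Fin N) (Fin N) ℂ :=
  Matrix.of fun k l => ∫ x, fourier ((l : ℤ) - (k : ℤ)) x ∂ν

theorem toeplitz_isHermitian (ν : Measure (AddCircle T)) (N : ℕ) :
    (toeplitz ν N).IsHermitian := by
  ext k l
  simp only [toeplitz, Matrix.conjTranspose_apply, Matrix.of_apply]
  rw [RCLike.star_def, ← integral_conj]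
  congr 1
  ext x
  rw [← fourier_neg, neg_sub]

/-- The trigonometric polynomial with coefficients `v`. -/
def trigPoly {N : ℕ} (v : Fin N → ℂ) (x : AddCircle T) : ℂ :=
  ∑ l : Fin N, v l * fourier (l : ℤ) x

theorem continuous_trigPoly {N : ℕ} (v : Fin N → ℂ) :
    Continuous (trigPoly v : AddCircle T → ℂ) := by
  unfold trigPoly
  fun_prop

theorem trace_toeplitz (ν : Measure (AddCircle T)) (N : ℕ) :
    (toeplitz ν N).trace.re = N * ν.real Set.univ := by
  simp [Matrix.trace, toeplitz]

variable [hT : Fact (0 < T)]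

theorem integrable_fourier (ν : Measure (AddCircle T)) [IsFiniteMeasure ν] (n : ℤ) :
    Integrable (fun x => fourier n x) ν :=
  (fourier n : C(AddCircle T, ℂ)).continuous.integrable_of_hasCompactSupport
    (HasCompactSupport.of_compactSpace _)

theorem integrable_trigPoly_sq (ν : Measure (AddCircle T)) [IsFiniteMeasure ν] {N : ℕ}
    (v : Fin N → ℂ) : Integrable (fun x => ‖trigPoly v x‖ ^ 2) ν :=
  ((continuous_trigPoly v).norm.pow 2).integrable_of_hasCompactSupport
    (HasCompactSupport.of_compactSpace _)

theorem quadForm_toeplitz (ν : Measure (AddCircle T)) [IsFiniteMeasure ν] {N : ℕ}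
    (v : Fin N → ℂ) :
    (star v ⬝ᵥ (toeplitz ν N).mulVec v).re = ∫ x, ‖trigPoly v x‖ ^ 2 ∂ν := by
  have key : star v ⬝ᵥ (toeplitz ν N).mulVec v = ((∫ x, ‖trigPoly v x‖ ^ 2 ∂ν : ℝ) : ℂ) := by
    rw [← integral_complex_ofReal]
    have : ∀ x : AddCircle T, ((‖trigPoly v x‖ ^ 2 : ℝ) : ℂ) =
        ∑ k, ∑ l, star (v k) * (v l * fourier ((l : ℤ) - (k : ℤ)) x) := by
      intro x
      push_cast
      rw [← Complex.conj_mul', trigPoly, map_sum, Finset.sum_mul_sum]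
      refine Finset.sum_congr rfl fun k _ => Finset.sum_congr rfl fun l _ => ?_
      rw [sub_eq_add_neg, fourier_add, fourier_neg, map_mul, RCLike.star_def]
      ring
    simp_rw [this]
    have hint : ∀ k l : Fin N,
        Integrable (fun x => star (v k) * (v l * fourier ((l : ℤ) - (k : ℤ)) x)) ν :=
      fun k l => ((integrable_fourier ν _).const_mul _).const_mul _
    rw [integral_finsetSum _ fun k _ => integrable_finsetSum _ fun l _ => hint k l]
    simp only [dotProduct, Matrix.mulVec, Pi.star_apply, Finset.mul_sum]
    refine Finset.sum_congr rfl fun k _ => ?_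
    rw [integral_finsetSum _ fun l _ => hint k l]
    refine Finset.sum_congr rfl fun l _ => ?_
    rw [integral_const_mul, integral_const_mul, toeplitz, Matrix.of_apply, mul_comm (v l)]
  rw [key, Complex.ofReal_re]

theorem quadForm_toeplitz_nonneg (ν : Measure (AddCircle T)) [IsFiniteMeasure ν] {N : ℕ}
    (v : Fin N → ℂ) : 0 ≤ (star v ⬝ᵥ (toeplitz ν N).mulVec v).re := by
  rw [quadForm_toeplitz]
  positivity

/-- The form is the integral of `‖trigPoly v‖²`, so an inequality between measures passes to the
forms. The shape is the one required by `effectiveRank_le_add`. -/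
theorem quadForm_toeplitz_le {ν ν₁ ν₂ : Measure (AddCircle T)} [IsFiniteMeasure ν]
    [IsFiniteMeasure ν₁] [IsFiniteMeasure ν₂] {K : ℝ} (hK : 0 ≤ K)
    (h : ν ≤ ENNReal.ofReal K • ν₁ + ν₂) {N : ℕ} (v : Fin N → ℂ) :
    (star v ⬝ᵥ (toeplitz ν N).mulVec v).re ≤
      K * (star v ⬝ᵥ (toeplitz ν₁ N).mulVec v).re + (star v ⬝ᵥ (toeplitz ν₂ N).mulVec v).re := by
  simp only [quadForm_toeplitz]
  have h1 := (integrable_trigPoly_sq ν₁ v).smul_measure (ENNReal.ofReal_ne_top (r := K))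
  have h2 := integrable_trigPoly_sq ν₂ v
  refine (integral_mono_measure h (ae_of_all _ fun x => by positivity) (h1.add_measure h2)).trans ?_
  rw [integral_add_measure h1 h2, integral_smul_measure, ENNReal.toReal_ofReal hK, smul_eq_mul]

theorem integral_fourier_haarAddCircle (n : ℤ) :
    ∫ x, fourier n x ∂(AddCircle.haarAddCircle (T := T)) = if n = 0 then 1 else 0 := by
  split_ifs with h
  · subst h; simp
  · have := integral_eq_zero_of_add_right_eq_neg (μ := AddCircle.haarAddCircle (T := T))
      (fourier_add_half_inv_index h hT.out)
    exact this

theorem toeplitz_haarAddCircle (N : ℕ) :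
    toeplitz (AddCircle.haarAddCircle (T := T)) N = 1 := by
  ext k l
  rw [toeplitz, Matrix.of_apply, integral_fourier_haarAddCircle, Matrix.one_apply]
  refine if_congr ?_ rfl rfl
  rw [Fin.ext_iff]
  omega

/-- A restriction is dominated by Haar measure, whose Toeplitz matrix is the identity. -/
theorem quadForm_toeplitz_restrict_le (A : Set (AddCircle T)) {N : ℕ} (v : Fin N → ℂ) :
    (star v ⬝ᵥ (toeplitz (AddCircle.haarAddCircle.restrict A) N).mulVec v).re ≤
      ∑ i, ‖v i‖ ^ 2 := by
  have h := quadForm_toeplitz_le (K := 1) (ν₂ := 0) zero_le_one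
    (by simpa using Measure.restrict_le_self (μ := AddCircle.haarAddCircle (T := T)) (s := A)) v
  refine h.trans (le_of_eq ?_)
  rw [toeplitz_haarAddCircle, quadForm_toeplitz 0]
  simp only [Matrix.one_mulVec, integral_zero_measure, dotProduct, Pi.star_apply, RCLike.star_def,
    Complex.conj_mul', Complex.re_sum]
  simp [← Complex.ofReal_pow]

/-- Parseval for the indicator of `A`, whose squared L² norm is the measure of `A`. -/
theorem hasSum_sq_fourierCoeff_indicator {A : Set (AddCircle T)} (hA : MeasurableSet A) :
    HasSum (fun n : ℤ => ‖∫ x in A, fourier (-n) x ∂AddCircle.haarAddCircle‖ ^ 2)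
      (AddCircle.haarAddCircle.real A) := by
  have h := hasSum_sq_fourierCoeff
    (indicatorConstLp 2 hA (measure_ne_top AddCircle.haarAddCircle A) (1 : ℂ))
  have hae := indicatorConstLp_coeFn (p := 2) (hs := hA)
    (hμs := measure_ne_top AddCircle.haarAddCircle A) (c := (1 : ℂ))
  convert h using 1
  · ext n
    rw [fourierCoeff_congr_ae hae, fourierCoeff, ← integral_indicator hA]
    congr 3
    ext x
    by_cases hx : x ∈ A <;> simp [hx]
  · rw [integral_congr_ae (hae.mono fun x hx => by rw [hx]), ← integral_indicator_one hA]
    congr 1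
    ext x
    by_cases hx : x ∈ A <;> simp [hx]

/-- Finitely many indices, all in `[-L, L]`, carry nearly all of `s`; every row at distance at least
`L` from both ends contains all of them, and only `2 L` rows are lost. -/
theorem eventually_le_sum_toeplitz {b : ℤ → ℝ} (hb : ∀ n, 0 ≤ b n) {s : ℝ} (hs : HasSum b s)
    {δ : ℝ} (hδ : 0 < δ) :
    ∀ᶠ N : ℕ in atTop, N * (s - δ) ≤ ∑ k : Fin N, ∑ l : Fin N, b ((k : ℤ) - (l : ℤ)) := by
  obtain ⟨F, hF⟩ := (hs.eventually (lt_mem_nhds (sub_lt_self s (half_pos hδ)))).exists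
  obtain ⟨L, hL⟩ : ∃ L : ℕ, ∀ n ∈ F, n.natAbs ≤ L :=
    ⟨F.sup Int.natAbs, fun n hn => Finset.le_sup hn⟩
  have hs0 : 0 ≤ s := hs.nonneg hb
  have hrow : ∀ N k : ℕ, L ≤ k → k + L < N →
      s - δ / 2 ≤ ∑ l ∈ Finset.range N, b ((k : ℤ) - (l : ℤ)) := by
    intro N k h1 h2
    have himg : ∑ l ∈ F.image (fun n => ((k : ℤ) - n).toNat), b ((k : ℤ) - (l : ℤ)) =
        ∑ n ∈ F, b n := by
      rw [Finset.sum_image]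
      · refine Finset.sum_congr rfl fun n hn => ?_
        have := hL n hn
        congr 1
        omega
      · intro n hn n' hn' h
        have := hL n hn
        have := hL n' hn'
        simp only at h
        omega
    refine hF.le.trans (himg.symm.le.trans ?_)
    refine Finset.sum_le_sum_of_subset_of_nonneg ?_ fun _ _ _ => hb _
    intro l hl
    obtain ⟨n, hn, rfl⟩ := Finset.mem_image.mp hl
    have := hL n hn
    rw [Finset.mem_range]
    omega
  -- Makes the loss `2 L s` from the boundary rows at most `N δ / 2`; the other half of `δ` went
  -- into the truncation to `F`.
  obtain ⟨N₀, hN₀⟩ := exists_nat_ge (4 * L * s / δ)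
  filter_upwards [eventually_ge_atTop N₀, eventually_ge_atTop (2 * L)] with N h1 h2
  rw [Fin.sum_univ_eq_sum_range (fun k => ∑ l : Fin N, b ((k : ℤ) - (l : ℤ)))]
  have hnn : ∀ k : ℕ, 0 ≤ ∑ l : Fin N, b ((k : ℤ) - (l : ℤ)) :=
    fun k => Finset.sum_nonneg fun _ _ => hb _
  have h3 : ∑ k ∈ Finset.Ico L (N - L), (s - δ / 2) ≤
      ∑ k ∈ Finset.range N, ∑ l : Fin N, b ((k : ℤ) - (l : ℤ)) := by
    refine (Finset.sum_le_sum fun k hk => ?_).trans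
      (Finset.sum_le_sum_of_subset_of_nonneg (fun k hk => ?_) fun k _ _ => hnn k)
    · rw [Finset.mem_Ico] at hk
      rw [Fin.sum_univ_eq_sum_range (fun l => b ((k : ℤ) - (l : ℤ)))]
      exact hrow N k hk.1 (by omega)
    · rw [Finset.mem_Ico] at hk
      rw [Finset.mem_range]
      omega
  refine le_trans ?_ h3
  rw [Finset.sum_const, Nat.card_Ico, nsmul_eq_mul, show N - L - L = N - 2 * L by omega,
    Nat.cast_sub h2]
  push_cast
  have h4 : 4 * L * s ≤ δ * N := by
    rw [div_le_iff₀ hδ] at hN₀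
    have : (N₀ : ℝ) ≤ N := by exact_mod_cast h1
    nlinarith
  nlinarith [mul_nonneg (Nat.cast_nonneg (α := ℝ) L) hδ.le]

theorem eventually_le_sum_sq_toeplitz {A : Set (AddCircle T)} (hA : MeasurableSet A)
    {δ : ℝ} (hδ : 0 < δ) :
    ∀ᶠ N : ℕ in atTop, N * (AddCircle.haarAddCircle.real A - δ) ≤
      ∑ k, ∑ l, ‖toeplitz (AddCircle.haarAddCircle.restrict A) N k l‖ ^ 2 := by
  filter_upwards [eventually_le_sum_toeplitz (fun n => by positivity)
    (hasSum_sq_fourierCoeff_indicator hA) hδ] with N hN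
  refine hN.trans (le_of_eq ?_)
  simp [toeplitz]

/-- The trace is exactly `N` times the measure of `A`, and Parseval puts the squared Frobenius norm
within `N η δ` of it from below; the factor `η` absorbs the division in the contraction bound. -/
theorem eventually_effectiveRank_toeplitz_restrict_le {A : Set (AddCircle T)}
    (hA : MeasurableSet A) {η : ℝ} (hη : 0 < η) {δ : ℝ} (hδ : 0 < δ) :
    ∀ᶠ N : ℕ in atTop,
      (effectiveRank (toeplitz_isHermitian (AddCircle.haarAddCircle.restrict A) N) η : ℝ) ≤
        N * (AddCircle.haarAddCircle.real A + δ) := by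
  filter_upwards [eventually_le_sum_sq_toeplitz hA (mul_pos hη hδ)] with N hN
  refine (effectiveRank_le_of_contraction _ (quadForm_toeplitz_nonneg _)
    (quadForm_toeplitz_restrict_le A) hη).trans ?_
  rw [trace_toeplitz, measureReal_restrict_apply_univ, mul_add]
  gcongr
  rw [div_le_iff₀ hη]
  linarith

theorem eventually_le_effectiveRank_toeplitz_restrict {A : Set (AddCircle T)}
    (hA : MeasurableSet A) {η : ℝ} (hη : η < 1) {δ : ℝ} (hδ : 0 < δ) :
    ∀ᶠ N : ℕ in atTop, N * (AddCircle.haarAddCircle.real A - δ) ≤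
      (effectiveRank (toeplitz_isHermitian (AddCircle.haarAddCircle.restrict A) N) η : ℝ) := by
  filter_upwards [eventually_le_sum_sq_toeplitz hA (mul_pos (sub_pos.mpr hη) hδ)] with N hN
  refine le_trans ?_ (le_effectiveRank_of_contraction _ (quadForm_toeplitz_nonneg _)
    (quadForm_toeplitz_restrict_le A) hη)
  rw [trace_toeplitz, measureReal_restrict_apply_univ, mul_sub]
  gcongr
  rw [div_le_iff₀ (sub_pos.mpr hη)]
  linarith

end Toeplitz

/-! ### From indicators to an integrable density. -/

section Density

variable {T : ℝ} [hT : Fact (0 < T)]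

/-- Continuity from below along the sets `{1 / (n + 1) ≤ f}`, which exhaust `{f ≠ 0}`. -/
theorem exists_measure_superlevel_gt (f : AddCircle T → ENNReal) {δ : ℝ}
    (hδ : 0 < δ) : ∃ c : ℝ, 0 < c ∧
      (AddCircle.haarAddCircle.real {x | f x ≠ 0} - δ <
        AddCircle.haarAddCircle.real {x | ENNReal.ofReal c ≤ f x}) := by
  have hU : {x | f x ≠ 0} = ⋃ n : ℕ, {x | ENNReal.ofReal (1 / ((n : ℝ) + 1)) ≤ f x} := by
    ext x
    simp only [Set.mem_ofPred_eq, Set.mem_iUnion]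
    constructor
    · intro hx
      by_cases htop : f x = ⊤
      · exact ⟨0, by simp [htop]⟩
      obtain ⟨n, hn⟩ := exists_nat_one_div_lt (ENNReal.toReal_pos hx htop)
      exact ⟨n, ENNReal.ofReal_le_of_le_toReal hn.le⟩
    · rintro ⟨n, hn⟩ h0
      rw [h0, nonpos_iff_eq_zero, ENNReal.ofReal_eq_zero] at hn
      exact absurd hn (not_le.mpr (by positivity))
  have hmono : Monotone fun n : ℕ => {x | ENNReal.ofReal (1 / ((n : ℝ) + 1)) ≤ f x} := by
    intro n m hnm x hx
    refine le_trans (ENNReal.ofReal_le_ofReal ?_) hx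
    gcongr
  have ht := tendsto_measure_iUnion_atTop (μ := AddCircle.haarAddCircle (T := T)) hmono
  rw [← hU] at ht
  have ht' := (ENNReal.tendsto_toReal (measure_ne_top _ _)).comp ht
  obtain ⟨n, hn⟩ := (ht'.eventually (lt_mem_nhds (sub_lt_self _ hδ))).exists
  exact ⟨_, by positivity, hn⟩

/-- Dominated convergence: `f` is finite almost everywhere, so the truncated difference is
eventually 0 there. -/
theorem exists_lintegral_sub_lt {α : Type*} [MeasurableSpace α] {μ : Measure α}
    {f : α → ENNReal} (hf : Measurable f)
    (hfin : ∫⁻ x, f x ∂μ ≠ ⊤) {δ : ENNReal} (hδ : 0 < δ) :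
    ∃ K : ℕ, 0 < K ∧ ∫⁻ x, (f x - K) ∂μ < δ := by
  have ht : Tendsto (fun K : ℕ => ∫⁻ x, (f x - K) ∂μ) atTop (𝓝 (∫⁻ _, 0 ∂μ)) := by
    refine tendsto_lintegral_of_dominated_convergence f (fun K => hf.sub_const _)
      (fun K => ae_of_all _ fun x => tsub_le_self) hfin ?_
    filter_upwards [ae_lt_top hf hfin] with x hx
    obtain ⟨n, hn⟩ := ENNReal.exists_nat_gt hx.ne
    refine tendsto_const_nhds.congr' ?_
    filter_upwards [eventually_ge_atTop n] with K hK
    rw [tsub_eq_zero_of_le]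
    exact hn.le.trans (by exact_mod_cast hK)
  rw [lintegral_zero] at ht
  obtain ⟨K, h1, h2⟩ := ((eventually_gt_atTop 0).and (ht.eventually (gt_mem_nhds hδ))).exists
  exact ⟨K, h1, h2⟩

/-- Asymptotic effective rank of the Toeplitz matrices of an absolutely continuous measure: the
fraction of non-negligible eigenvalues is the measure of the support of the density. -/
theorem eventually_effectiveRank_toeplitz_withDensity {f : AddCircle T → ENNReal}
    (hf : Measurable f) (hfin : ∫⁻ x, f x ∂AddCircle.haarAddCircle ≠ ⊤) {δ : ℝ} (hδ : 0 < δ) :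
    ∃ ε₀ > 0, ∀ ε ∈ Set.Ioo 0 ε₀, ∀ᶠ N : ℕ in atTop,
      |(effectiveRank (toeplitz_isHermitian (AddCircle.haarAddCircle.withDensity f) N) ε : ℝ) / N -
        AddCircle.haarAddCircle.real {x | f x ≠ 0}| < δ := by
  have hδ3 : 0 < δ / 3 := by positivity
  obtain ⟨c, hc, hcF⟩ := exists_measure_superlevel_gt f hδ3
  set F := {x | f x ≠ 0} with hF
  have hFm : MeasurableSet F := (measurableSet_singleton 0).compl.preimage hf
  set A := {x | ENNReal.ofReal c ≤ f x} with hA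
  have hAm : MeasurableSet A := measurableSet_le measurable_const hf
  have : IsFiniteMeasure (AddCircle.haarAddCircle.withDensity f) := isFiniteMeasure_withDensity hfin
  -- With `ε < c / 4` the lower comparison closes: `ε / c + 1 / 4 ≤ 1 / 2`. Here `c` depends on `δ`
  -- only, whereas `K` below may depend on `ε`.
  refine ⟨c / 4, by positivity, fun ε hε => ?_⟩
  have hε0 : 0 < ε := hε.1
  -- The excess over `K` has mass below `(ε / 2)(δ / 3)`, so Markov's inequality leaves at most `N δ
  -- / 3` of its eigenvalues above `ε / 2`.
  obtain ⟨K, hK, hKδ⟩ := exists_lintegral_sub_lt hf hfin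
    (δ := ENNReal.ofReal (ε / 2 * (δ / 3))) (by simpa using by positivity)
  have hKr : (0 : ℝ) < K := by exact_mod_cast hK
  set h : AddCircle T → ENNReal := fun x => f x - K with hh
  have hhm : Measurable h := hf.sub_const _
  have : IsFiniteMeasure (AddCircle.haarAddCircle.withDensity h) := isFiniteMeasure_withDensity (hKδ.trans_le le_top).ne
  have hup : AddCircle.haarAddCircle.withDensity f ≤ ENNReal.ofReal K • AddCircle.haarAddCircle.restrict F + AddCircle.haarAddCircle.withDensity h := by
    rw [← withDensity_indicator_one hFm, ← withDensity_smul _ (measurable_one.indicator hFm),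
      ← withDensity_add_right _ hhm]
    refine withDensity_mono (ae_of_all _ fun x => ?_)
    by_cases hx : x ∈ F
    · simpa [hx, hh] using le_add_tsub
    · have : f x = 0 := by simpa [hF] using hx
      simp [this]
  have hlow : AddCircle.haarAddCircle.restrict A ≤ ENNReal.ofReal (1 / c) • AddCircle.haarAddCircle.withDensity f + 0 := by
    rw [add_zero, ← withDensity_indicator_one hAm, ← withDensity_smul _ hf]
    refine withDensity_mono (ae_of_all _ fun x => ?_)
    by_cases hx : x ∈ A
    · have : ENNReal.ofReal c ≤ f x := hx
      simp only [hx, Set.indicator_of_mem, Pi.one_apply, Pi.smul_apply, smul_eq_mul]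
      calc (1 : ENNReal) = ENNReal.ofReal (1 / c) * ENNReal.ofReal c := by
            rw [← ENNReal.ofReal_mul (by positivity), one_div_mul_cancel hc.ne']; simp
        _ ≤ _ := by gcongr
    · simp [hx]
  filter_upwards [eventually_effectiveRank_toeplitz_restrict_le hFm
      (show 0 < ε / (2 * K) by positivity) hδ3,
    eventually_le_effectiveRank_toeplitz_restrict hAm (show (1 / 2 : ℝ) < 1 by norm_num) hδ3,
    eventually_gt_atTop 0] with N h1 h2 hN
  have hNr : (0 : ℝ) < N := by exact_mod_cast hN
  -- The threshold splits as `ε = K · ε / (2 K) + ε / 2`.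
  have hU := effectiveRank_le_add (toeplitz_isHermitian (AddCircle.haarAddCircle.withDensity f) N)
    (toeplitz_isHermitian (AddCircle.haarAddCircle.restrict F) N) (toeplitz_isHermitian (AddCircle.haarAddCircle.withDensity h) N)
    (K := K) (a := ε) (β := ε / (2 * K)) (γ := ε / 2) hKr.le (by field_simp; norm_num)
    (quadForm_toeplitz_le hKr.le hup)
  -- No remainder is needed here; the zero measure fills the third slot, and its count vanishes by
  -- the trace bound `h02`.
  have hL := effectiveRank_le_add (toeplitz_isHermitian (AddCircle.haarAddCircle.restrict A) N)
    (toeplitz_isHermitian (AddCircle.haarAddCircle.withDensity f) N) (toeplitz_isHermitian (0 : Measure (AddCircle T)) N)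
    (K := 1 / c) (a := 1 / 2) (β := ε) (γ := 1 / 4) (by positivity)
    (by
      have : 1 / c * ε ≤ 1 / 4 := by rw [one_div_mul_eq_div, div_le_iff₀ hc]; linarith [hε.2]
      linarith)
    (quadForm_toeplitz_le (by positivity) hlow)
  have hh2 := effectiveRank_mul_le_trace (toeplitz_isHermitian (AddCircle.haarAddCircle.withDensity h) N)
    (quadForm_toeplitz_nonneg _) (ε / 2)
  have h02 := effectiveRank_mul_le_trace (toeplitz_isHermitian (0 : Measure (AddCircle T)) N)
    (quadForm_toeplitz_nonneg _) (1 / 4)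
  rw [trace_toeplitz] at hh2 h02
  have hmass : (AddCircle.haarAddCircle.withDensity h).real Set.univ < ε / 2 * (δ / 3) := by
    rw [measureReal_def, withDensity_apply _ MeasurableSet.univ, Measure.restrict_univ]
    exact (ENNReal.lt_ofReal_iff_toReal_lt (hKδ.trans_le le_top).ne).mp hKδ
  simp only [measureReal_zero, Pi.zero_apply, mul_zero] at h02
  have hU' := (Nat.cast_le (α := ℝ)).mpr hU
  have hL' := (Nat.cast_le (α := ℝ)).mpr hL
  rw [Nat.cast_add] at hU' hL'
  generalize (effectiveRank (toeplitz_isHermitian (AddCircle.haarAddCircle.withDensity f) N) ε : ℝ) = r at *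
  generalize (effectiveRank (toeplitz_isHermitian (AddCircle.haarAddCircle.withDensity h) N) (ε / 2) : ℝ) = r₂ at *
  have hr₂ : r₂ ≤ N * (δ / 3) := by
    have : r₂ * (ε / 2) ≤ N * (δ / 3) * (ε / 2) := by nlinarith
    exact le_of_mul_le_mul_right this (by positivity)
  rw [abs_sub_lt_iff, sub_lt_iff_lt_add, sub_lt_comm, div_lt_iff₀ hNr, lt_div_iff₀ hNr]
  constructor <;> nlinarith

end Density

/-! ### Wrapping the line around the circle. -/

section Circle

variable {T : ℝ}

theorem coe_eq_coe_iff_exists_zsmul {x y : ℝ} :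
    (x : AddCircle T) = y ↔ ∃ n : ℤ, n • T = x - y := by
  rw [← sub_eq_zero, ← AddCircle.coe_sub, AddCircle.coe_eq_zero_iff]

theorem measurableSet_image_Ioo (a b : ℝ) :
    MeasurableSet ((fun x : ℝ => (x : AddCircle T)) '' Set.Ioo a b) :=
  (QuotientAddGroup.isOpenMap_coe (Set.Ioo a b) isOpen_Ioo).measurableSet

variable [hT : Fact (0 < T)]

theorem haarAddCircle_eq_zero_iff {S : Set (AddCircle T)} :
    AddCircle.haarAddCircle S = 0 ↔ volume S = 0 := by
  simp [AddCircle.volume_eq_smul_haarAddCircle, hT.out]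

theorem haarAddCircle_eq_zero_iff_preimage {S : Set (AddCircle T)} (hS : MeasurableSet S) :
    AddCircle.haarAddCircle S = 0 ↔ volume ((fun x : ℝ => (x : AddCircle T)) ⁻¹' S) = 0 := by
  rw [haarAddCircle_eq_zero_iff]
  constructor
  · intro h
    rw [← Set.inter_univ ((fun x : ℝ => (x : AddCircle T)) ⁻¹' S), ← iUnion_Ioc_zsmul hT.out,
      Set.inter_iUnion, measure_iUnion_null_iff]
    intro n
    rw [add_smul, one_smul]
    exact (AddCircle.add_projection_respects_measure T _ hS).symm.trans h
  · intro h
    rw [AddCircle.add_projection_respects_measure T 0 hS]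
    exact measure_mono_null Set.inter_subset_left h

theorem haarAddCircle_image_eq_zero {S : Set ℝ} (hS : volume S = 0)
    (hm : MeasurableSet ((fun x : ℝ => (x : AddCircle T)) '' S)) :
    AddCircle.haarAddCircle ((fun x : ℝ => (x : AddCircle T)) '' S) = 0 := by
  rw [haarAddCircle_eq_zero_iff_preimage hm]
  -- The preimage of the image is contained in the union of countably many translates of `S`.
  refine measure_mono_null (t := ⋃ n : ℤ, (fun x : ℝ => x + n • T) ⁻¹' S) ?_ ?_
  · rintro x ⟨y, hy, hxy⟩
    obtain ⟨n, hn⟩ := coe_eq_coe_iff_exists_zsmul.mp hxy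
    refine Set.mem_iUnion.mpr ⟨n, ?_⟩
    simpa [hn] using hy
  · refine measure_iUnion_null fun n => ?_
    rw [measure_preimage_add_right, hS]

theorem haarAddCircle_image_Ioo {a b : ℝ} (hab : a ≤ b) (hT' : b - a ≤ T) :
    AddCircle.haarAddCircle.real ((fun x : ℝ => (x : AddCircle T)) '' Set.Ioo a b) =
      (b - a) / T := by
  have hvol : volume ((fun x : ℝ => (x : AddCircle T)) '' Set.Ioo a b) =
      ENNReal.ofReal (b - a) := by
    rw [AddCircle.add_projection_respects_measure T a (measurableSet_image_Ioo a b),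
      ← Real.volume_Ioo]
    congr 1
    ext x
    constructor
    · rintro ⟨⟨y, hy, hxy⟩, hx⟩
      have hy' : y ∈ Set.Ioc a (a + T) := ⟨hy.1, by linarith [hy.2]⟩
      exact (AddCircle.coe_eq_coe_iff_of_mem_Ioc hy' hx).mp hxy ▸ hy
    · intro hx
      exact ⟨⟨x, hx, rfl⟩, hx.1, by linarith [hx.2]⟩
  rw [AddCircle.volume_eq_smul_haarAddCircle, Measure.smul_apply, smul_eq_mul] at hvol
  have := congrArg ENNReal.toReal hvol
  rw [ENNReal.toReal_mul, ENNReal.toReal_ofReal hT.out.le,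
    ENNReal.toReal_ofReal (sub_nonneg.mpr hab)] at this
  rw [measureReal_def, eq_div_iff hT.out.ne', mul_comm, this]

theorem haarAddCircle_iUnion_image_Ioo {Q : ℕ} {a b : Fin Q → ℝ} (hab : ∀ q, a q ≤ b q)
    (hdisj : ∀ q q', q ≠ q' → ∀ x ∈ Set.Ioo (a q) (b q),
      ∀ y ∈ Set.Ioo (a q') (b q'), ∀ n : ℤ, x - y ≠ n * T) :
    AddCircle.haarAddCircle.real
        (⋃ q, (fun x : ℝ => (x : AddCircle T)) '' Set.Ioo (a q) (b q)) =
      min (∑ q, (b q - a q) / T) 1 := by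
  have hnn : ∀ q, 0 ≤ (b q - a q) / T := fun q => div_nonneg (sub_nonneg.mpr (hab q)) hT.out.le
  -- An interval longer than `T` wraps onto itself, so the length formula fails; but it already
  -- fills the circle up to a null set, and both sides are 1. Otherwise the images are disjoint, the
  -- lengths add, and the minimum is automatic in a probability space.
  by_cases hlong : ∃ q, T < b q - a q
  · obtain ⟨q, hq⟩ := hlong
    rw [min_eq_right]
    · refine le_antisymm measureReal_le_one ?_
      have h1 := haarAddCircle_image_Ioo (T := T) (a := a q) (b := a q + T)
        (by linarith [hT.out]) (by linarith)
      rw [add_sub_cancel_left, div_self hT.out.ne'] at h1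
      rw [← h1]
      refine measureReal_mono (Set.subset_iUnion_of_subset q (Set.image_mono ?_))
      exact Set.Ioo_subset_Ioo_right (by linarith)
    · refine le_trans ?_ (Finset.single_le_sum (fun i _ => hnn i) (Finset.mem_univ q))
      rw [le_div_iff₀ hT.out, one_mul]
      exact hq.le
  · push Not at hlong
    have hsum : AddCircle.haarAddCircle.real
        (⋃ q, (fun x : ℝ => (x : AddCircle T)) '' Set.Ioo (a q) (b q)) =
        ∑ q, (b q - a q) / T := by
      rw [measureReal_iUnion_fintype]
      · exact Finset.sum_congr rfl fun q _ => haarAddCircle_image_Ioo (hab q) (hlong q)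
      · intro q q' hqq'
        refine Set.disjoint_left.mpr ?_
        rintro _ ⟨x, hx, rfl⟩ ⟨y, hy, hxy⟩
        obtain ⟨n, hn⟩ := coe_eq_coe_iff_exists_zsmul.mp hxy.symm
        refine hdisj q q' hqq' x hx y hy n ?_
        rw [← hn, zsmul_eq_mul]
      · exact fun q => measurableSet_image_Ioo _ _
    rw [hsum, min_eq_left]
    exact hsum ▸ measureReal_le_one

/-- A measure on the line with an integrable density that is positive inside finitely many
intervals and zero outside, wrapped around the circle, has a density which is supported, up to null
sets, on the image of the intervals. -/
theorem exists_density_map_coe {Q : ℕ} {a b : Fin Q → ℝ} {P : ℝ → ℝ} (hP_int : Integrable P)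
    (hP_pos : ∀ q, ∀ τ ∈ Set.Ioo (a q) (b q), 0 < P τ)
    (hP_zero : ∀ τ, τ ∉ ⋃ q, Set.Icc (a q) (b q) → P τ = 0) :
    ∃ f : AddCircle T → ENNReal, Measurable f ∧ ∫⁻ x, f x ∂AddCircle.haarAddCircle ≠ ⊤ ∧
      (volume.withDensity fun τ => ENNReal.ofReal (P τ)).map (fun x : ℝ => (x : AddCircle T)) =
        AddCircle.haarAddCircle.withDensity f ∧
      {x | f x ≠ 0} =ᵐ[AddCircle.haarAddCircle]
        (⋃ q, (fun x : ℝ => (x : AddCircle T)) '' Set.Ioo (a q) (b q) : Set (AddCircle T)) := by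
  set π : ℝ → AddCircle T := fun x => (x : AddCircle T) with hπ
  have hπm : Measurable π := AddCircle.measurable_mk'
  set κ : Measure ℝ := volume.withDensity fun τ => ENNReal.ofReal (P τ) with hκ
  have hκfin : IsFiniteMeasure κ := isFiniteMeasure_withDensity_ofReal hP_int.2
  set ν := κ.map π with hν
  have hκ0 : ∀ S : Set ℝ, κ S = 0 ↔ volume ({τ | 0 < P τ} ∩ S) = 0 := by
    intro S
    rw [hκ, withDensity_apply_eq_zero' hP_int.1.aemeasurable.ennreal_ofReal]
    simp
  have hac : ν ≪ AddCircle.haarAddCircle := by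
    refine Measure.AbsolutelyContinuous.mk fun S hS h0 => ?_
    rw [hν, Measure.map_apply hπm hS]
    exact withDensity_absolutelyContinuous _ _ ((haarAddCircle_eq_zero_iff_preimage hS).mp h0)
  have hνf := Measure.withDensity_rnDeriv_eq ν _ hac
  set f := ν.rnDeriv AddCircle.haarAddCircle with hf
  have hfm : Measurable f := Measure.measurable_rnDeriv _ _
  set E : Set (AddCircle T) := ⋃ q, π '' Set.Ioo (a q) (b q) with hE
  have hEm : MeasurableSet E := MeasurableSet.iUnion fun q => measurableSet_image_Ioo _ _
  have hFm : MeasurableSet {x | f x ≠ 0} := (measurableSet_singleton 0).compl.preimage hfm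
  refine ⟨f, hfm, (Measure.lintegral_rnDeriv_lt_top _ _).ne, hνf.symm, ?_⟩
  have hν0 : ∀ S, ν S = 0 ↔ AddCircle.haarAddCircle ({x | f x ≠ 0} ∩ S) = 0 := by
    intro S
    conv_lhs => rw [← hνf]
    rw [withDensity_apply_eq_zero hfm]
  rw [ae_eq_set]
  constructor
  · rw [Set.sdiff_eq, ← hν0, hν, Measure.map_apply hπm hEm.compl, hκ0]
    -- Where `P > 0` but outside the open intervals, only endpoints remain.
    refine measure_mono_null (t := Set.range a ∪ Set.range b) ?_
      (((Set.finite_range a).union (Set.finite_range b)).measure_zero _)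
    rintro τ ⟨hτ, hτE⟩
    by_contra hend
    rw [Set.mem_union, not_or, Set.mem_range, Set.mem_range, not_exists, not_exists] at hend
    by_cases hmem : τ ∈ ⋃ q, Set.Icc (a q) (b q)
    · obtain ⟨q, hq⟩ := Set.mem_iUnion.mp hmem
      exact hτE (Set.mem_iUnion.mpr ⟨q, τ, ⟨lt_of_le_of_ne hq.1 (hend.1 q),
        lt_of_le_of_ne hq.2 (hend.2 q ∘ Eq.symm)⟩, rfl⟩)
    · exact hτ.ne' (hP_zero τ hmem)
  · have hSm : MeasurableSet (E \ {x | f x ≠ 0}) := hEm.diff hFm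
    have hS0 : ν (E \ {x | f x ≠ 0}) = 0 := by
      rw [hν0, Set.inter_sdiff_self, measure_empty]
    rw [hν, Measure.map_apply hπm hSm, hκ0] at hS0
    -- The part of `E` where `f` vanishes is null for `ν`. Since `P > 0` on each interval, its lift
    -- to that interval is Lebesgue null, and projecting back keeps it null.
    have hdec : E \ {x | f x ≠ 0} =
        ⋃ q, π '' (π ⁻¹' (E \ {x | f x ≠ 0}) ∩ Set.Ioo (a q) (b q)) := by
      simp_rw [Set.image_preimage_inter]
      rw [← Set.inter_iUnion, Set.inter_eq_left.mpr Set.sdiff_subset]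
    rw [hdec, measure_iUnion_null_iff]
    intro q
    refine haarAddCircle_image_eq_zero (measure_mono_null ?_ hS0) ?_
    · exact fun τ hτ => ⟨hP_pos q τ hτ.2, hτ.1⟩
    · rw [Set.image_preimage_inter]
      exact hSm.inter (measurableSet_image_Ioo _ _)

end Circle

/-! ### Invariance of a uniform phase under half a turn. -/

section HalfTurn

instance fact_two_pi_pos : Fact (0 < 2 * Real.pi) := ⟨Real.two_pi_pos⟩

/-- Rotation of a phase by half a turn, with representatives in `(-π, π]`. -/
def halfTurn (x : ℝ) : ℝ :=
  (AddCircle.equivIoc (2 * Real.pi) (-Real.pi) ((x : AddCircle (2 * Real.pi)) + (Real.pi : ℝ)) : ℝ)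

theorem exp_halfTurn (x : ℝ) :
    Complex.exp (Complex.I * (halfTurn x : ℂ)) = -Complex.exp (Complex.I * (x : ℂ)) := by
  have h : ((halfTurn x : ℝ) : AddCircle (2 * Real.pi)) = ((x + Real.pi : ℝ) : AddCircle _) := by
    rw [halfTurn, AddCircle.coe_equivIoc, AddCircle.coe_add]
  obtain ⟨n, hn⟩ := coe_eq_coe_iff_exists_zsmul.mp h
  have hx : halfTurn x = x + Real.pi + n * (2 * Real.pi) := by
    rw [zsmul_eq_mul] at hn
    linarith
  rw [hx]
  push_cast
  rw [show Complex.I * ((x : ℂ) + Real.pi + n * (2 * Real.pi)) =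
    Complex.I * x + Real.pi * Complex.I + n * (2 * Real.pi * Complex.I) by ring,
    Complex.exp_add, Complex.exp_add, Complex.exp_int_mul_two_pi_mul_I, Complex.exp_pi_mul_I]
  ring

/-- Project to the circle, translate by `π`, lift back: each step preserves measure. -/
theorem measurePreserving_halfTurn_restrict :
    MeasurePreserving halfTurn (volume.restrict (Set.Ioc (-Real.pi) Real.pi))
      (volume.restrict (Set.Ioc (-Real.pi) Real.pi)) := by
  have h1 := AddCircle.measurePreserving_mk (2 * Real.pi) (-Real.pi)
  have h2 := measurePreserving_add_right (volume : Measure (AddCircle (2 * Real.pi)))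
    ((Real.pi : ℝ) : AddCircle (2 * Real.pi))
  have h3 := AddCircle.measurePreserving_equivIoc (2 * Real.pi) (a := -Real.pi)
  have h4 := measurePreserving_subtype_coe (μa := (volume : Measure ℝ))
    (measurableSet_Ioc (a := -Real.pi) (b := -Real.pi + 2 * Real.pi))
  have h : MeasurePreserving halfTurn
      (volume.restrict (Set.Ioc (-Real.pi) (-Real.pi + 2 * Real.pi)))
      (volume.restrict (Set.Ioc (-Real.pi) (-Real.pi + 2 * Real.pi))) :=
    h4.comp (h3.comp (h2.comp h1))
  rwa [show -Real.pi + 2 * Real.pi = Real.pi by ring] at h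

theorem measurePreserving_halfTurn_of_isUniform {Ω : Type*} [MeasurableSpace Ω] {μ : Measure Ω}
    {X : Ω → ℝ} (hX : pdf.IsUniform X (Set.Ioo (-Real.pi) Real.pi) μ volume) :
    MeasurePreserving halfTurn (μ.map X) (μ.map X) := by
  rw [show μ.map X = _ from hX, ProbabilityTheory.cond, Measure.restrict_congr_set Ioo_ae_eq_Ioc]
  exact measurePreserving_halfTurn_restrict.smul_measure _

end HalfTurn

/-! ### The channel: cross terms vanish and the covariance is Toeplitz. -/

namespace Channel

variable {Ω : Type*} [MeasurableSpace Ω] {μ : Measure Ω} {M Nh Nv Np : ℕ}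

/-- The space of all initial phases and all path parameters. -/
abbrev Params (M : ℕ) : Type :=
  (Fin M × Fin 2 × Fin 2 → ℝ) × (Fin M → ℝ × ℝ × ℝ × ℝ × ℝ × ℝ)

/-- The initial phases and the other path parameters (angles, cross polarization ratio, delay), as
one random variable. -/
def params (H : Channel Ω μ M Nh Nv Np) (ω : Ω) : Params M :=
  (fun x => H.phase x.1 x.2.1 x.2.2 ω,
    fun m => (H.zoa m ω, H.aoa m ω, H.zod m ω, H.aod m ω, H.xpr m ω, H.delay m ω))

theorem measurable_params (H : Channel Ω μ M Nh Nv Np) : Measurable H.params := by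
  refine Measurable.prodMk (measurable_pi_lambda _ fun x => H.measurable_phase _ _ _)
    (measurable_pi_lambda _ fun m => ?_)
  exact (H.measurable_zoa m).prodMk ((H.measurable_aoa m).prodMk ((H.measurable_zod m).prodMk
    ((H.measurable_aod m).prodMk ((H.measurable_xpr m).prodMk (H.measurable_delay m)))))

/-- Rotation of all initial phases of path `m` by half a turn. -/
def flipPath (m : Fin M) (z : Params M) : Params M :=
  (fun x => if x.1 = m then halfTurn (z.1 x) else z.1 x, z.2)

theorem measurePreserving_flipPath [IsProbabilityMeasure μ] (H : Channel Ω μ M Nh Nv Np)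
    (m : Fin M) : MeasurePreserving (flipPath m) (μ.map H.params) (μ.map H.params) := by
  have hX : Measurable fun ω (x : Fin M × Fin 2 × Fin 2) => H.phase x.1 x.2.1 x.2.2 ω :=
    H.measurable_params.fst
  have hY : Measurable fun ω (m : Fin M) =>
      (H.zoa m ω, H.aoa m ω, H.zod m ω, H.aod m ω, H.xpr m ω, H.delay m ω) :=
    H.measurable_params.snd
  -- Independence makes the law a product, so a map acting on each phase separately can be checked
  -- factor by factor.
  have hlaw : μ.map H.params =
      (Measure.pi fun x : Fin M × Fin 2 × Fin 2 => μ.map (H.phase x.1 x.2.1 x.2.2)).prod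
        (μ.map fun ω (m : Fin M) =>
          (H.zoa m ω, H.aoa m ω, H.zod m ω, H.aod m ω, H.xpr m ω, H.delay m ω)) := by
    rw [← (iIndepFun_iff_map_fun_eq_pi_map
      fun x => (H.measurable_phase _ _ _).aemeasurable).mp H.phase_indep]
    exact H.phase_indep_rest.map_prod_eq_prod_map_map hX.aemeasurable hY.aemeasurable
  have hprob : ∀ x : Fin M × Fin 2 × Fin 2,
      IsProbabilityMeasure (μ.map (H.phase x.1 x.2.1 x.2.2)) :=
    fun x => Measure.isProbabilityMeasure_map (H.measurable_phase _ _ _).aemeasurable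
  have := Measure.isProbabilityMeasure_map (μ := μ) hY.aemeasurable
  have hpi : MeasurePreserving
      (fun (φ : Fin M × Fin 2 × Fin 2 → ℝ) x => if x.1 = m then halfTurn (φ x) else φ x)
      (Measure.pi fun x : Fin M × Fin 2 × Fin 2 => μ.map (H.phase x.1 x.2.1 x.2.2))
      (Measure.pi fun x : Fin M × Fin 2 × Fin 2 => μ.map (H.phase x.1 x.2.1 x.2.2)) := by
    refine measurePreserving_pi _ _
      (f := fun (x : Fin M × Fin 2 × Fin 2) (y : ℝ) => if x.1 = m then halfTurn y else y)
      fun x => ?_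
    by_cases hx : x.1 = m
    · simpa only [hx, if_true] using
        measurePreserving_halfTurn_of_isUniform (H.phase_uniform m x.2.1 x.2.2)
    · simp only [hx, if_false]
      exact MeasurePreserving.id _
  rw [hlaw]
  exact hpi.prod (MeasurePreserving.id _)

/-- The integral equals its own negative; no integrability is needed. -/
theorem integral_eq_zero_of_flipPath [IsProbabilityMeasure μ] (H : Channel Ω μ M Nh Nv Np)
    (m : Fin M) {F : Params M → ℂ} (hF : Measurable F) (hflip : ∀ z, F (flipPath m z) = -F z) :
    ∫ ω, F (H.params ω) ∂μ = 0 := by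
  have h1 : ∫ z, F z ∂(μ.map H.params) = ∫ z, F (flipPath m z) ∂(μ.map H.params) := by
    have hmp := H.measurePreserving_flipPath m
    conv_lhs => rw [← hmp.map_eq]
    exact integral_map hmp.measurable.aemeasurable hF.aestronglyMeasurable
  simp_rw [hflip, integral_neg] at h1
  rw [← integral_map H.measurable_params.aemeasurable hF.aestronglyMeasurable]
  exact self_eq_neg.mp h1

/-- The gain of path `m` at antenna `s` as a function of the phases and the path parameters. -/
def gainOf (H : Channel Ω μ M Nh Nv Np) (t : ℝ) (s : (Fin Nh × Fin Nv) × Fin Np) (m : Fin M)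
    (z : Params M) : ℂ :=
  steeringH H.Dh H.wavelength Nh (z.2 m).2.2.1 (z.2 m).2.2.2.1 s.1.1 *
    steeringV H.Dv H.wavelength Nv (z.2 m).2.2.1 s.1.2 *
  (((fun i => (H.Frx i (z.2 m).1 (z.2 m).2.1 : ℂ)) ⬝ᵥ
      (polarizationMatrix (z.2 m).2.2.2.2.1 (fun i j => z.1 (m, i, j))).mulVec
        (fun j => (H.Ftx s.2 j (z.2 m).2.2.1 (z.2 m).2.2.2.1 : ℂ))) *
    Complex.exp (Complex.I *
      ((2 * Real.pi * (sphericalUnit (z.2 m).1 (z.2 m).2.1 ⬝ᵥ H.velocity) / H.wavelength * t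
        : ℝ) : ℂ)))

theorem gainMatrix_apply (H : Channel Ω μ M Nh Nv Np) (t : ℝ) (ω : Ω)
    (s : (Fin Nh × Fin Nv) × Fin Np) (m : Fin M) :
    H.gainMatrix t ω s m = H.gainOf t s m (H.params ω) := by
  rw [gainMatrix, Matrix.mul_apply, Fintype.sum_prod_type, Finset.sum_eq_single m,
    Finset.sum_eq_single s.2]
  · simp only [Matrix.blockDiagonal_apply, coeffMatrix, Matrix.of_apply, if_true, steeringMatrix]
    rfl
  · intro p _ hp
    simp [Matrix.blockDiagonal_apply, hp.symm]
  · simp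
  · intro m' _ hm
    simp [coeffMatrix, hm]
  · simp

theorem measurable_gainOf (H : Channel Ω μ M Nh Nv Np) (t : ℝ) (s : (Fin Nh × Fin Nv) × Fin Np)
    (m : Fin M) : Measurable (H.gainOf t s m) := by
  have h1 : ∀ i, Measurable fun z : Params M => H.Frx i (z.2 m).1 (z.2 m).2.1 := fun i =>
    (H.measurable_Frx i).comp (f := fun z : Params M => ((z.2 m).1, (z.2 m).2.1)) (by fun_prop)
  have h2 : ∀ j, Measurable fun z : Params M => H.Ftx s.2 j (z.2 m).2.2.1 (z.2 m).2.2.2.1 :=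
    fun j => (H.measurable_Ftx s.2 j).comp
      (f := fun z : Params M => ((z.2 m).2.2.1, (z.2 m).2.2.2.1)) (by fun_prop)
  unfold gainOf steeringH steeringV sphericalUnit polarizationMatrix
  simp only [dotProduct, Matrix.mulVec, Fin.sum_univ_two, Fin.sum_univ_three, Matrix.of_apply,
    Matrix.cons_val, if_true, zero_ne_one, one_ne_zero, if_false]
  fun_prop

theorem gainOf_flipPath_self (H : Channel Ω μ M Nh Nv Np) (t : ℝ)
    (s : (Fin Nh × Fin Nv) × Fin Np) (m : Fin M) (z : Params M) :
    H.gainOf t s m (flipPath m z) = -H.gainOf t s m z := by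
  simp only [gainOf, flipPath, polarizationMatrix, if_true, exp_halfTurn, dotProduct,
    Matrix.mulVec, Matrix.of_apply, Fin.sum_univ_two]
  ring

theorem gainOf_flipPath_of_ne (H : Channel Ω μ M Nh Nv Np) (t : ℝ)
    (s : (Fin Nh × Fin Nv) × Fin Np) {m m' : Fin M} (h : m' ≠ m) (z : Params M) :
    H.gainOf t s m' (flipPath m z) = H.gainOf t s m' z := by
  simp only [gainOf, flipPath, h, if_false]

theorem measurable_gainMatrix (H : Channel Ω μ M Nh Nv Np) (t : ℝ)
    (s : (Fin Nh × Fin Nv) × Fin Np) (m : Fin M) :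
    Measurable fun ω => H.gainMatrix t ω s m := by
  simp_rw [gainMatrix_apply]
  exact (H.measurable_gainOf t s m).comp H.measurable_params

theorem measurable_delayResponse (f₁ Δf : ℝ) (N : ℕ) (k : Fin N) :
    Measurable fun τ => delayResponse f₁ Δf N τ k := by
  unfold delayResponse
  fun_prop

theorem norm_delayResponse (f₁ Δf : ℝ) (N : ℕ) (τ : ℝ) (k : Fin N) :
    ‖delayResponse f₁ Δf N τ k‖ = 1 := by
  rw [delayResponse, ← mul_neg, ← Complex.ofReal_neg, mul_comm, Complex.norm_exp_ofReal_mul_I]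

/-- The first frequency cancels, leaving the phase `2π (l - k) Δf τ`: a character of the circle of
length `1 / Δf`. -/
theorem delayResponse_mul_conj (f₁ Δf : ℝ) (N : ℕ) (τ : ℝ) (k l : Fin N) :
    delayResponse f₁ Δf N τ k * (starRingEnd ℂ) (delayResponse f₁ Δf N τ l) =
      fourier ((l : ℤ) - (k : ℤ)) (τ : AddCircle (1 / Δf)) := by
  rw [fourier_coe_apply, delayResponse, delayResponse, ← Complex.exp_conj, ← Complex.exp_add]
  congr 1
  simp only [subcarrier, map_neg, map_mul, Complex.conj_I, Complex.conj_ofReal]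
  push_cast
  simp only [one_div, div_inv_eq_mul]
  ring

theorem integral_cross_path_eq_zero [IsProbabilityMeasure μ] (H : Channel Ω μ M Nh Nv Np)
    (f₁ Δf t : ℝ) {N : ℕ} (k l : Fin N) (s : (Fin Nh × Fin Nv) × Fin Np) {m m' : Fin M}
    (h : m' ≠ m) :
    ∫ ω, H.gainMatrix t ω s m * delayResponse f₁ Δf N (H.delay m ω) k *
      (starRingEnd ℂ) (H.gainMatrix t ω s m' * delayResponse f₁ Δf N (H.delay m' ω) l) ∂μ = 0 := by
  simp_rw [gainMatrix_apply]
  refine H.integral_eq_zero_of_flipPath m (F := fun z =>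
    H.gainOf t s m z * delayResponse f₁ Δf N (z.2 m).2.2.2.2.2 k *
      (starRingEnd ℂ) (H.gainOf t s m' z * delayResponse f₁ Δf N (z.2 m').2.2.2.2.2 l)) ?_ ?_
  · have hd : ∀ (m : Fin M) (k : Fin N),
        Measurable fun z : Params M => delayResponse f₁ Δf N (z.2 m).2.2.2.2.2 k := fun m k =>
      (measurable_delayResponse f₁ Δf N k).comp (by fun_prop)
    exact ((H.measurable_gainOf t s m).mul (hd m k)).mul
      (RCLike.continuous_conj.measurable.comp ((H.measurable_gainOf t s m').mul (hd m' l)))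
  · intro z
    rw [gainOf_flipPath_self, gainOf_flipPath_of_ne _ _ _ h]
    simp only [flipPath, neg_mul]

/-- Total power of path `m` over all antennas. -/
def pathPower (H : Channel Ω μ M Nh Nv Np) (t : ℝ) (m : Fin M) (ω : Ω) : ENNReal :=
  ∑ s, ‖H.gainMatrix t ω s m‖ₑ ^ 2

theorem measurable_pathPower (H : Channel Ω μ M Nh Nv Np) (t : ℝ) (m : Fin M) :
    Measurable (H.pathPower t m) := by
  unfold pathPower
  have := fun s => H.measurable_gainMatrix t s m
  fun_prop

theorem pathPower_toReal (H : Channel Ω μ M Nh Nv Np) (t : ℝ) (m : Fin M) (ω : Ω) :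
    (H.pathPower t m ω).toReal = ∑ s, ‖H.gainMatrix t ω s m‖ ^ 2 := by
  rw [pathPower, ENNReal.toReal_sum (by simp)]
  simp

theorem powerDelayProfile_univ (H : Channel Ω μ M Nh Nv Np) (t : ℝ) :
    H.powerDelayProfile t Set.univ = ∑ m, ∫⁻ ω, H.pathPower t m ω ∂μ := by
  rw [powerDelayProfile, Measure.finsetSum_apply]
  refine Finset.sum_congr rfl fun m _ => ?_
  rw [Measure.map_apply (H.measurable_delay m) MeasurableSet.univ, Set.preimage_univ,
    withDensity_apply _ MeasurableSet.univ, Measure.restrict_univ]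
  rfl

theorem lintegral_pathPower_ne_top (H : Channel Ω μ M Nh Nv Np) (t : ℝ)
    [IsFiniteMeasure (H.powerDelayProfile t)] (m : Fin M) :
    ∫⁻ ω, H.pathPower t m ω ∂μ ≠ ⊤ := by
  have h := measure_ne_top (H.powerDelayProfile t) Set.univ
  rw [powerDelayProfile_univ, ENNReal.sum_ne_top] at h
  exact h m (Finset.mem_univ m)

/-- No moments of field patterns or cross polarization ratios are assumed; finite total mass of the
power delay profile supplies the square integrability. -/
theorem memLp_gainMatrix (H : Channel Ω μ M Nh Nv Np) (t : ℝ)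
    [IsFiniteMeasure (H.powerDelayProfile t)] (s : (Fin Nh × Fin Nv) × Fin Np) (m : Fin M) :
    MemLp (fun ω => H.gainMatrix t ω s m) 2 μ := by
  refine ⟨(H.measurable_gainMatrix t s m).aestronglyMeasurable, ?_⟩
  rw [eLpNorm_lt_top_iff_lintegral_rpow_enorm_lt_top (by simp) (by simp)]
  refine lt_of_le_of_lt (lintegral_mono fun ω => ?_) (H.lintegral_pathPower_ne_top t m).lt_top
  simp only [ENNReal.toReal_ofNat, ENNReal.rpow_ofNat]
  exact Finset.single_le_sum (f := fun s => ‖H.gainMatrix t ω s m‖ₑ ^ 2)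
    (fun _ _ => zero_le) (Finset.mem_univ s)

theorem memLp_gainMatrix_mul_delayResponse (H : Channel Ω μ M Nh Nv Np) (f₁ Δf t : ℝ)
    [IsFiniteMeasure (H.powerDelayProfile t)] {N : ℕ} (k : Fin N)
    (s : (Fin Nh × Fin Nv) × Fin Np) (m : Fin M) :
    MemLp (fun ω => H.gainMatrix t ω s m * delayResponse f₁ Δf N (H.delay m ω) k) 2 μ := by
  refine (H.memLp_gainMatrix t s m).of_le ?_ (ae_of_all _ fun ω => ?_)
  · exact ((H.measurable_gainMatrix t s m).mul
      ((measurable_delayResponse f₁ Δf N k).comp (H.measurable_delay m))).aestronglyMeasurable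
  · rw [norm_mul, norm_delayResponse, mul_one]

theorem freqCov_apply [IsProbabilityMeasure μ] (H : Channel Ω μ M Nh Nv Np) (f₁ Δf t : ℝ)
    [IsFiniteMeasure (H.powerDelayProfile t)] (N : ℕ) (k l : Fin N) :
    H.freqCov f₁ Δf N t k l = ∑ m, ∫ ω, ((H.pathPower t m ω).toReal : ℂ) *
      fourier ((l : ℤ) - (k : ℤ)) (H.delay m ω : AddCircle (1 / Δf)) ∂μ := by
  have hint : ∀ s m m', Integrable (fun ω =>
      H.gainMatrix t ω s m * delayResponse f₁ Δf N (H.delay m ω) k *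
      (starRingEnd ℂ) (H.gainMatrix t ω s m' * delayResponse f₁ Δf N (H.delay m' ω) l)) μ :=
    fun s m m' => (H.memLp_gainMatrix_mul_delayResponse f₁ Δf t k s m).integrable_mul
      (H.memLp_gainMatrix_mul_delayResponse f₁ Δf t l s m').star
  have hexp : ∀ ω, ((H.channelMatrix f₁ Δf N t ω).transpose *
      (H.channelMatrix f₁ Δf N t ω).map (starRingEnd ℂ)) k l = ∑ s, ∑ m, ∑ m',
      H.gainMatrix t ω s m * delayResponse f₁ Δf N (H.delay m ω) k *
      (starRingEnd ℂ) (H.gainMatrix t ω s m' * delayResponse f₁ Δf N (H.delay m' ω) l) := by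
    intro ω
    simp only [Matrix.mul_apply, Matrix.transpose_apply, Matrix.map_apply, channelMatrix,
      delayMatrix, Matrix.of_apply, map_sum, Finset.sum_mul_sum]
  rw [freqCov, Matrix.of_apply]
  simp_rw [hexp]
  rw [integral_finsetSum _ fun s _ => integrable_finsetSum _ fun m _ =>
    integrable_finsetSum _ fun m' _ => hint s m m']
  have hdiag : ∀ s, ∫ ω, ∑ m, ∑ m',
      H.gainMatrix t ω s m * delayResponse f₁ Δf N (H.delay m ω) k *
      (starRingEnd ℂ) (H.gainMatrix t ω s m' * delayResponse f₁ Δf N (H.delay m' ω) l) ∂μ =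
      ∑ m, ∫ ω, H.gainMatrix t ω s m * delayResponse f₁ Δf N (H.delay m ω) k *
      (starRingEnd ℂ) (H.gainMatrix t ω s m * delayResponse f₁ Δf N (H.delay m ω) l) ∂μ := by
    intro s
    rw [integral_finsetSum _ fun m _ => integrable_finsetSum _ fun m' _ => hint s m m']
    refine Finset.sum_congr rfl fun m _ => ?_
    -- Only `m' = m` survives: the half turn of path `m` negates every other product.
    rw [integral_finsetSum _ fun m' _ => hint s m m', Finset.sum_eq_single m]
    · exact fun m' _ hm' => H.integral_cross_path_eq_zero f₁ Δf t k l s hm'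
    · simp
  simp_rw [hdiag]
  rw [Finset.sum_comm]
  refine Finset.sum_congr rfl fun m _ => ?_
  rw [← integral_finsetSum _ fun s _ => hint s m m]
  congr 1
  ext ω
  rw [pathPower_toReal, ← delayResponse_mul_conj]
  push_cast
  rw [Finset.sum_mul]
  refine Finset.sum_congr rfl fun s _ => ?_
  rw [map_mul, ← Complex.mul_conj']
  ring

/-- The frequency covariance matrix is the Toeplitz matrix of the power delay profile, wrapped
around the circle of length `1 / Δf`. -/
theorem freqCov_eq_toeplitz [IsProbabilityMeasure μ] (H : Channel Ω μ M Nh Nv Np) (f₁ Δf t : ℝ)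
    [Fact (0 < 1 / Δf)] [IsFiniteMeasure (H.powerDelayProfile t)] (N : ℕ) :
    H.freqCov f₁ Δf N t =
      toeplitz ((H.powerDelayProfile t).map fun x : ℝ => (x : AddCircle (1 / Δf))) N := by
  ext k l
  have hc : Continuous fun x : ℝ =>
      fourier ((l : ℤ) - (k : ℤ)) (x : AddCircle (1 / Δf)) :=
    (fourier _).continuous.comp (AddCircle.continuous_mk' _)
  have hfin : ∀ m, IsFiniteMeasure (μ.withDensity (H.pathPower t m)) := fun m =>
    isFiniteMeasure_withDensity (H.lintegral_pathPower_ne_top t m)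
  rw [freqCov_apply, toeplitz, Matrix.of_apply,
    integral_map AddCircle.measurable_mk'.aemeasurable
      (fourier _).continuous.aestronglyMeasurable]
  change _ = ∫ x : ℝ, _ ∂(∑ m, (μ.withDensity (H.pathPower t m)).map (H.delay m))
  rw [integral_finsetSum_measure]
  · refine Finset.sum_congr rfl fun m _ => ?_
    rw [integral_map (H.measurable_delay m).aemeasurable hc.aestronglyMeasurable,
      integral_withDensity_eq_integral_toReal_smul (H.measurable_pathPower t m)
        (ae_lt_top (H.measurable_pathPower t m) (H.lintegral_pathPower_ne_top t m))]
    simp only [Complex.real_smul]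
  · intro m _
    refine Integrable.of_bound hc.aestronglyMeasurable 1 (ae_of_all _ fun x => ?_)
    rw [fourier_apply, Circle.norm_coe]

end Channel

end Wideband

end

theorem proposition1 {Ω : Type*} [MeasurableSpace Ω] (μ : Measure Ω) [IsProbabilityMeasure μ]
    {M Nh Nv Np : ℕ} (H : Wideband.Channel Ω μ M Nh Nv Np)
    -- first subcarrier frequency, subcarrier spacing, time
    (f₁ Δf t : ℝ) (hΔf : 0 < Δf)
    -- the delay intervals
    {Q : ℕ} (τmin τmax : Fin Q → ℝ) (hτ : ∀ q, τmin q ≤ τmax q)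
    -- different intervals stay disjoint modulo the period of the delay response vectors
    (hdisj : ∀ q q', q ≠ q' → ∀ x ∈ Set.Ioo (τmin q) (τmax q),
      ∀ y ∈ Set.Ioo (τmin q') (τmax q'), ∀ n : ℤ, x - y ≠ n / Δf)
    -- the power delay profile has a density, non-zero inside the intervals and zero outside
    (P : ℝ → ℝ) (hP_int : Integrable P)
    (hP : H.powerDelayProfile t = volume.withDensity (fun τ => ENNReal.ofReal (P τ)))
    (hP_pos : ∀ q, ∀ τ ∈ Set.Ioo (τmin q) (τmax q), 0 < P τ)
    (hP_zero : ∀ τ, τ ∉ ⋃ q, Set.Icc (τmin q) (τmax q) → P τ = 0) :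
    ∀ δ > 0, ∃ ε₀ > 0, ∀ ε ∈ Set.Ioo 0 ε₀, ∀ᶠ N : ℕ in atTop,
      |(Wideband.effectiveRank (H.freqCov_isHermitian f₁ Δf N t) ε : ℝ) / N -
        min (∑ q, Δf * (τmax q - τmin q)) 1| < δ := by
  have hT : Fact (0 < 1 / Δf) := ⟨one_div_pos.mpr hΔf⟩
  obtain ⟨f, hf, hfin, hmap, hsupp⟩ := Wideband.exists_density_map_coe (T := 1 / Δf)
    hP_int hP_pos hP_zero
  have : IsFiniteMeasure (H.powerDelayProfile t) := by
    rw [hP]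
    exact isFiniteMeasure_withDensity_ofReal hP_int.2
  -- The limiting fraction is the Haar measure of the wrapped intervals; division by the period `1 /
  -- Δf` yields the factor `Δf`.
  have hρ : AddCircle.haarAddCircle.real {x | f x ≠ 0} =
      min (∑ q, Δf * (τmax q - τmin q)) 1 := by
    rw [measureReal_congr hsupp, Wideband.haarAddCircle_iUnion_image_Ioo hτ]
    · simp [mul_comm]
    · intro q q' hqq' x hx y hy n
      rw [mul_one_div]
      exact hdisj q q' hqq' x hx y hy n
  intro δ hδ
  obtain ⟨ε₀, hε₀, h⟩ := Wideband.eventually_effectiveRank_toeplitz_withDensity hf hfin hδ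
  refine ⟨ε₀, hε₀, fun ε hε => (h ε hε).mono fun N hN => ?_⟩
  have hcov : H.freqCov f₁ Δf N t =
      Wideband.toeplitz (AddCircle.haarAddCircle.withDensity f) N := by
    rw [H.freqCov_eq_toeplitz, hP, hmap]
  rw [hρ] at hN
  simpa only [hcov] using hN
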